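/- Let $I=\{1,\dots,n\}$ be a finite set of agents and let $X\subseteq\mathbb{R}^m$ be a polyhedron, i.e. an intersection of finitely many closed half-spaces (for instance a polyhedron contained in $\mathbb{R}^m_+$, or $\mathbb{R}^m_+$ itself). Suppose that each agent $i$ has a piecewise-linear concave utility function $u_i:X\to\mathbb{R}$, i.e. there are a finite nonempty index set $K_i$ and affine functions $u_{i,k}:\mathbb{R}^m\to\mathbb{R}$, $k\in K_i$, such that $u_i(x)=\min_{k\in K_i}u_{i,k}(x)$ for all $x\in X$. Let $\underline{u}_i=\inf_{x\in X}u_i(x)\in[-\infty,\infty)$ (for $X\neq\emptyset$) and define the utility possibility set $$U=\{w\in\mathbb{R}^n \mid \exists x\in X\ \forall i\in I:\ \underline{u}_i\le w_i\le u_i(x)\}.$$ Let $U^P$ be the set of Pareto optimal points of $U$, i.e. of those $w\in U$ for which there is no $v\in U$ with $v_i\ge w_i$ for all $i\in I$ and $v\ne w$. Let $U^{++}$ be the set of those $w\in U$ for which there is a vector $\phi\in\mathbb{R}^n$ with $\phi_i>0$ for all $i\in I$ such that $\sum_{i=1}^n\phi_i w_i\ge\sum_{i=1}^n\phi_i v_i$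 for all $v\in U$. Then $U^P=U^{++}$. In particular, every Pareto optimum maximizes some strictly positively weighted utilitarian sum. -/

import Mathlib

/-- A polyhedron in `ℝ^m`: the solution set of finitely many weak linear inequalities,
i.e. an intersection of finitely many closed half-spaces. -/
def IsPolyhedron {m : ℕ} (X : Set (Fin m → ℝ)) : Prop :=
  ∃ (r : ℕ) (A : Fin r → Fin m → ℝ) (b : Fin r → ℝ), X = {x | ∀ j, A j ⬝ᵥ x ≤ b j}

/-- A function `f : X → ℝ` on a subset of `ℝ^m` is piecewise-linear concave: it is the pointwise
minimum, over a finite nonempty index set `K`, of affine functions. -/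
def IsPLC {m : ℕ} {X : Set (Fin m → ℝ)} (f : X → ℝ) : Prop :=
  ∃ (K : Type) (_ : Finite K) (_ : Nonempty K) (a : K → ((Fin m → ℝ) →ᵃ[ℝ] ℝ)),
    ∀ x : X, IsLeast (Set.range fun k => a k x) (f x)

/-- The utility possibility set: all `w` for which some `x ∈ X` satisfies
`w i ∈ [inf_X u i, u i x]` for every agent `i`. The infimum is taken in the extended reals,
so if `u i` is unbounded below there is no lower bound on `w i`. -/
def utilityPossibilitySet {n : ℕ} {X : Type*} (u : Fin n → X → ℝ) : Set (Fin n → ℝ) :=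
  {w | ∃ x : X, ∀ i, (⨅ y : X, (u i y : EReal)) ≤ (w i : EReal) ∧ w i ≤ u i x}

/-- `U^P`: the Pareto optimal (maximal) points of `U`. On `Fin n → ℝ`, `w < v` means
`w i ≤ v i` for all `i` and `w ≠ v`. -/
def paretoSet {n : ℕ} (U : Set (Fin n → ℝ)) : Set (Fin n → ℝ) :=
  {w | w ∈ U ∧ ¬ ∃ v ∈ U, w < v}

/-- `U^{++}`: the points of `U` that maximize, over `U`, a weighted utilitarian sum
with strictly positive weights. -/
def positiveUtilitarianSet {n : ℕ} (U : Set (Fin n → ℝ)) : Set (Fin n → ℝ) :=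
  {w | w ∈ U ∧ ∃ φ : Fin n → ℝ, (∀ i, 0 < φ i) ∧ ∀ v ∈ U, φ ⬝ᵥ v ≤ φ ⬝ᵥ w}

/-!
The inclusion `U^{++} ⊆ U^P` holds for every set `U`: a weighted sum with strictly positive weights
is strictly monotone.

For `U^P ⊆ U^{++}`, let `w` be Pareto optimal. Then `w` maximizes `∑ i, v i` subject to `x ∈ X`,
`v i ≤ u i x` and `w i ≤ v i`. The last constraint makes the lower bound `inf_X u i ≤ v i`
automatic, so, since `X` is a polyhedron and each `u i` is a minimum of finitely many affine
functions, this is a feasible linear program in `(x, v)`. Linear programming duality, in the form of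
the affine Farkas lemma `affine_farkas`, gives nonnegative multipliers for its constraints. Moving
the terms `ν i * (v i - w i)` of the constraints `w i ≤ v i` to the other side of the dual
inequality shows that the strictly positive weights `1 + ν i` support `U` at `w`
(`exists_pos_weights_of_maximal`).
-/

/-- **Farkas' lemma** for finitely many linear functionals on an arbitrary real vector space: if
nonnegativity of all `f j`, `j ∈ s`, forces `0 ≤ g`, then `g` is a conic combination of the `f j`. -/
theorem linear_farkas {E ι : Type*} [AddCommGroup E] [Module ℝ E] (s : Finset ι)
    (f : ι → E →ₗ[ℝ] ℝ) (g : E →ₗ[ℝ] ℝ)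
    (h : ∀ x, (∀ j ∈ s, 0 ≤ f j x) → 0 ≤ g x) :
    ∃ c : ι → ℝ, (∀ j, 0 ≤ c j) ∧ ∀ x, g x = ∑ j ∈ s, c j * f j x := by
  classical
  induction s using Finset.induction_on generalizing f g with
  | empty =>
    refine ⟨0, fun _ => le_rfl, fun x => ?_⟩
    have h1 := h x (by simp)
    have h2 := h (-x) (by simp)
    rw [map_neg] at h2
    simp only [Finset.sum_empty]
    linarith
  | insert a s ha ih =>
    by_cases hs : ∀ x, (∀ j ∈ s, 0 ≤ f j x) → 0 ≤ g x
    · obtain ⟨c, hc, hg⟩ := ih f g hs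
      refine ⟨Function.update c a 0, fun j => ?_, fun x => ?_⟩
      · by_cases hj : j = a
        · simp [hj]
        · simpa [hj] using hc j
      · rw [Finset.sum_insert ha, Function.update_self, zero_mul, zero_add, hg x]
        refine Finset.sum_congr rfl fun j hj => ?_
        rw [Function.update_of_ne (ne_of_mem_of_not_mem hj ha)]
    · push Not at hs
      obtain ⟨y, hy, hgy⟩ := hs
      have hay : f a y < 0 := by
        by_contra! hay
        exact hgy.not_ge (h y (by simpa [hay] using hy))
      -- Project along `y` onto the kernel of `f a`; there the constraint `0 ≤ f a` is vacuous.
      set t : ℝ := (-f a y)⁻¹ with ht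
      have ht0 : 0 < t := by rw [ht]; exact inv_pos.2 (by linarith)
      have hty : t * f a y = -1 := by
        rw [ht, inv_neg, neg_mul, inv_mul_cancel₀ hay.ne]
      obtain ⟨c, hc, hg⟩ := ih (fun j => f j + (t * f j y) • f a) (g + (t * g y) • f a) (by
        intro x hx
        have := h (x + (t * f a x) • y) (by
          intro j hj
          rcases Finset.mem_insert.1 hj with rfl | hj
          · rw [map_add, map_smul, smul_eq_mul, mul_right_comm, hty]
            linarith
          · have := hx j hj
            simp only [LinearMap.add_apply, LinearMap.smul_apply, smul_eq_mul] at this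
            simp only [map_add, map_smul, smul_eq_mul]
            linarith)
        simp only [map_add, map_smul, smul_eq_mul] at this
        simp only [LinearMap.add_apply, LinearMap.smul_apply, smul_eq_mul]
        linarith)
      refine ⟨Function.update c a (∑ j ∈ s, c j * (t * f j y) - t * g y), fun j => ?_, fun x => ?_⟩
      · by_cases hj : j = a
        · subst hj
          rw [Function.update_self, sub_nonneg]
          exact (mul_neg_of_pos_of_neg ht0 hgy).le.trans <| Finset.sum_nonneg fun i hi =>
            mul_nonneg (hc i) (mul_nonneg ht0.le (hy i hi))
        · simpa [hj] using hc j
      · have hgx := hg x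
        simp only [LinearMap.add_apply, LinearMap.smul_apply, smul_eq_mul, mul_add,
          Finset.sum_add_distrib] at hgx
        have h1 : ∑ j ∈ s, Function.update c a (∑ j ∈ s, c j * (t * f j y) - t * g y) j * f j x
            = ∑ j ∈ s, c j * f j x := by
          refine Finset.sum_congr rfl fun j hj => ?_
          rw [Function.update_of_ne (ne_of_mem_of_not_mem hj ha)]
        have h2 : ∑ j ∈ s, c j * (t * f j y * f a x) = (∑ j ∈ s, c j * (t * f j y)) * f a x := by
          rw [Finset.sum_mul]
          exact Finset.sum_congr rfl fun j _ => by ring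
        rw [Finset.sum_insert ha, Function.update_self, h1]
        rw [h2] at hgx
        linarith

/-- **Affine Farkas lemma**: if a feasible finite system of affine inequalities `0 ≤ f j` implies
`0 ≤ g`, then `g` dominates a nonnegative combination of the `f j`. -/
theorem affine_farkas {E ι : Type*} [AddCommGroup E] [Module ℝ E] [Fintype ι]
    (f : ι → E →ᵃ[ℝ] ℝ) (g : E →ᵃ[ℝ] ℝ) (p : E) (hp : ∀ j, 0 ≤ f j p)
    (h : ∀ x, (∀ j, 0 ≤ f j x) → 0 ≤ g x) :
    ∃ c : ι → ℝ, (∀ j, 0 ≤ c j) ∧ ∀ x, ∑ j, c j * f j x ≤ g x := by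
  -- Homogenize: `φ` becomes the functional `(x, t) ↦ φ.linear x + t * φ 0`, and `0 ≤ t` is added.
  let H : (E →ᵃ[ℝ] ℝ) → (E × ℝ →ₗ[ℝ] ℝ) := fun φ =>
    φ.linear.comp (LinearMap.fst ℝ E ℝ) + φ 0 • LinearMap.snd ℝ E ℝ
  have H_apply (φ : E →ᵃ[ℝ] ℝ) (x : E) (t : ℝ) : H φ (x, t) = φ.linear x + φ 0 * t := by simp [H]
  have decomp (φ : E →ᵃ[ℝ] ℝ) (x : E) : φ x = φ.linear x + φ 0 := congrFun φ.decomp x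
  obtain ⟨c, hc, hg⟩ := linear_farkas Finset.univ
    (fun o : Option ι => o.elim (LinearMap.snd ℝ E ℝ) fun j => H (f j)) (H g) (by
      rintro ⟨x, t⟩ hx
      have ht : 0 ≤ t := by simpa using hx none (Finset.mem_univ _)
      have hfx (j : ι) : 0 ≤ (f j).linear x + f j 0 * t := by
        simpa [H_apply] using hx (some j) (Finset.mem_univ _)
      rw [H_apply]
      rcases ht.eq_or_lt with rfl | ht
      · -- `x` is a recession direction: `p + s • x` stays feasible for all `s ≥ 0`.
        simp only [mul_zero, add_zero] at hfx ⊢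
        have ray (s : ℝ) (hs : 0 ≤ s) : 0 ≤ g p + s * g.linear x := by
          have := h (p + s • x) (fun j => by
            have h1 := hp j
            have h2 := mul_nonneg hs (hfx j)
            rw [decomp] at h1 ⊢
            rw [map_add, map_smul, smul_eq_mul]
            linarith)
          rw [decomp, map_add, map_smul, smul_eq_mul] at this
          rw [decomp]
          linarith
        by_contra! hneg
        have hgp : 0 ≤ g p := h p hp
        have := ray ((g p + 1) / -g.linear x) (div_nonneg (by linarith) (by linarith))
        have hcancel : (g p + 1) / -g.linear x * g.linear x = -(g p + 1) := by
          field_simp [hneg.ne]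
        linarith
      · have scale (φ : E →ᵃ[ℝ] ℝ) : φ.linear x + φ 0 * t = t * φ (t⁻¹ • x) := by
          rw [decomp φ (t⁻¹ • x), map_smul, smul_eq_mul]
          field_simp
        rw [scale]
        refine mul_nonneg ht.le (h _ fun j => ?_)
        have := hfx j
        rw [scale] at this
        exact nonneg_of_mul_nonneg_right this ht)
  refine ⟨fun j => c (some j), fun j => hc _, fun x => ?_⟩
  have hx := hg (x, 1)
  rw [Fintype.sum_option] at hx
  simp only [Option.elim, LinearMap.snd_apply, H_apply, mul_one, ← decomp] at hx
  linarith [hc none]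

/-- If `w` is Pareto optimal among the vectors `v` lying below finitely many affine functions
`a i k` at some point of a polyhedron, then `w` maximizes over these `v` a weighted sum with strictly
positive weights. -/
theorem exists_pos_weights_of_maximal {n m r : ℕ} {K : Fin n → Type} [∀ i, Fintype (K i)]
    (A : Fin r → Fin m → ℝ) (b : Fin r → ℝ) (a : ∀ i, K i → ((Fin m → ℝ) →ᵃ[ℝ] ℝ))
    (w : Fin n → ℝ) (x₀ : Fin m → ℝ) (hx₀ : ∀ j, A j ⬝ᵥ x₀ ≤ b j) (hw : ∀ i k, w i ≤ a i k x₀)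
    (hmax : ∀ x v, (∀ j, A j ⬝ᵥ x ≤ b j) → (∀ i k, v i ≤ a i k x) → ¬ w < v) :
    ∃ φ : Fin n → ℝ, (∀ i, 0 < φ i) ∧
      ∀ x v, (∀ j, A j ⬝ᵥ x ≤ b j) → (∀ i k, v i ≤ a i k x) → φ ⬝ᵥ v ≤ φ ⬝ᵥ w := by
  let X : (Fin m → ℝ) × (Fin n → ℝ) →ᵃ[ℝ] (Fin m → ℝ) := (LinearMap.fst ℝ _ _).toAffineMap
  let V (i : Fin n) : (Fin m → ℝ) × (Fin n → ℝ) →ᵃ[ℝ] ℝ :=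
    (LinearMap.proj i ∘ₗ LinearMap.snd ℝ _ _).toAffineMap
  let poly (j : Fin r) : (Fin m → ℝ) × (Fin n → ℝ) →ᵃ[ℝ] ℝ :=
    AffineMap.const ℝ _ (b j) - (dotProductBilin ℝ ℝ (A j)).toAffineMap.comp X
  let below (q : Σ i, K i) : (Fin m → ℝ) × (Fin n → ℝ) →ᵃ[ℝ] ℝ := (a q.1 q.2).comp X - V q.1
  let above (i : Fin n) : (Fin m → ℝ) × (Fin n → ℝ) →ᵃ[ℝ] ℝ := V i - AffineMap.const ℝ _ (w i)
  let g : (Fin m → ℝ) × (Fin n → ℝ) →ᵃ[ℝ] ℝ := AffineMap.const ℝ _ (∑ i, w i) -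
    (∑ i, LinearMap.proj i ∘ₗ LinearMap.snd ℝ _ _ : (Fin m → ℝ) × (Fin n → ℝ) →ₗ[ℝ] ℝ).toAffineMap
  have poly_apply (j) (x) (v) : poly j (x, v) = b j - A j ⬝ᵥ x := by simp [poly, X]
  have below_apply (q) (x) (v) : below q (x, v) = a q.1 q.2 x - v q.1 := by simp [below, X, V]
  have above_apply (i) (x) (v) : above i (x, v) = v i - w i := by simp [above, V]
  have g_apply (x) (v) : g (x, v) = ∑ i, w i - ∑ i, v i := by simp [g]
  obtain ⟨c, hc, hg⟩ := affine_farkas (Sum.elim poly (Sum.elim below above)) g (x₀, w)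
    (by rintro (j | q | i) <;> simp [poly_apply, below_apply, above_apply, hx₀, hw])
    (by
      rintro ⟨x, v⟩ hxv
      have hwv : w ≤ v := fun i => by
        simpa [above_apply] using hxv (.inr (.inr i))
      have hnot := hmax x v (fun j => by simpa [poly_apply] using hxv (.inl j))
        (fun i k => by simpa [below_apply] using hxv (.inr (.inl ⟨i, k⟩)))
      rw [g_apply, eq_of_le_of_not_lt hwv hnot, sub_self])
  refine ⟨fun i => 1 + c (.inr (.inr i)), fun i => by linarith [hc (.inr (.inr i))],
    fun x v hx hv => ?_⟩
  have key := hg (x, v)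
  simp only [Fintype.sum_sum_type, Sum.elim_inl, Sum.elim_inr, poly_apply, below_apply,
    above_apply, g_apply] at key
  have h1 : 0 ≤ ∑ j, c (.inl j) * (b j - A j ⬝ᵥ x) :=
    Finset.sum_nonneg fun j _ => mul_nonneg (hc _) (sub_nonneg.2 (hx j))
  have h2 : 0 ≤ ∑ q : Σ i, K i, c (.inr (.inl q)) * (a q.1 q.2 x - v q.1) :=
    Finset.sum_nonneg fun q _ => mul_nonneg (hc _) (sub_nonneg.2 (hv _ _))
  simp only [dotProduct, add_mul, one_mul, Finset.sum_add_distrib]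
  simp only [mul_sub, Finset.sum_sub_distrib] at key h1 h2
  linarith

/-- A maximizer of a strictly positively weighted sum is Pareto optimal. -/
theorem positiveUtilitarianSet_subset_paretoSet {n : ℕ} (U : Set (Fin n → ℝ)) :
    positiveUtilitarianSet U ⊆ paretoSet U := by
  rintro w ⟨hw, φ, hφ, hmax⟩
  refine ⟨hw, ?_⟩
  rintro ⟨v, hv, hwv⟩
  obtain ⟨hle, i, hi⟩ := Pi.lt_def.1 hwv
  exact (hmax v hv).not_gt <| Finset.sum_lt_sum
    (fun j _ => mul_le_mul_of_nonneg_left (hle j) (hφ j).le)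
    ⟨i, Finset.mem_univ i, mul_lt_mul_of_pos_left hi (hφ i)⟩

theorem theorem4 {n m : ℕ} (X : Set (Fin m → ℝ)) (hX : IsPolyhedron X)
    (u : Fin n → X → ℝ) (hu : ∀ i, IsPLC (u i)) :
    paretoSet (utilityPossibilitySet u) = positiveUtilitarianSet (utilityPossibilitySet u) := by
  refine Set.Subset.antisymm ?_ (positiveUtilitarianSet_subset_paretoSet _)
  rintro w ⟨hwU, hmax⟩
  obtain ⟨r, A, b, rfl⟩ := hX
  choose K hK _ a ha using hu
  have (i : Fin n) : Fintype (K i) := Fintype.ofFinite (K i)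
  have le_iff (i : Fin n) (x) (t : ℝ) : t ≤ u i x ↔ ∀ k, t ≤ a i k x := by
    rw [le_isGLB_iff (ha i x).isGLB]
    exact Set.forall_mem_range
  obtain ⟨x₀, hx₀⟩ := id hwU
  obtain ⟨φ, hφ, hφmax⟩ := exists_pos_weights_of_maximal A b a w x₀ x₀.2
    (fun i => (le_iff i x₀ (w i)).1 (hx₀ i).2) (by
      intro x v hx hv hwv
      refine hmax ⟨v, ⟨⟨x, hx⟩, fun i => ⟨?_, (le_iff i ⟨x, hx⟩ (v i)).2 (hv i)⟩⟩, hwv⟩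
      exact (hx₀ i).1.trans (EReal.coe_le_coe_iff.2 (hwv.le i)))
  refine ⟨hwU, φ, hφ, ?_⟩
  rintro v ⟨x, hxv⟩
  exact hφmax x v x.2 fun i => (le_iff i x (v i)).1 (hxv i).2
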